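/- Let $A\in\mathbb{R}^{n\times n}$ be symmetric with all eigenvalues in $[0,2c]$, $c>0$, let $g,v\in\mathbb{R}^n$ with $\beta:=\|g-Av\|=1$ ($\|\cdot\|$ the Euclidean norm), and let $t\ge 0$. For an integer $k\ge 1$ let $V_k=[v_1\ \dots\ v_k]\in\mathbb{R}^{n\times k}$ be the matrix of the vectors produced by $k$ steps of the Arnoldi process for $A$ with starting vector $g-Av$ (Gram–Schmidt orthonormalization, $v_1=(g-Av)/\|g-Av\|$; $v_{j+1}$ is the normalization of $w_j:=Av_j-\sum_{i\le j}(v_i^TAv_j)v_i$; if the process terminates, i.e. some $w_j=0$, all further vectors are set to $0$), and let $H_k=V_k^TAV_k$. With the entire function $\varphi(z)=(e^z-1)/z$, $\varphi(0)=1$, and $e_1=(1,0,\dots,0)^T\in\mathbb{R}^k$, let $$y_k(t)=v+V_k\,t\,\varphi(-tH_k)(\beta e_1)$$ be the Krylov subspace approximation to the solution of $y'=-Ay+g$, $y(0)=v$, and let $$r_k(t)=-Ay_k(t)+g-y_k'(t)$$ be its residual. Proposition P3 (bound for $k$ of order at least $ct$, symmetric case). If $k\ge\max\{5ct,2\}$,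 then $y_k$ is differentiable at $t$ and $$\|r_k(t)\|\le\frac{16\,(ct)^k}{(2k-1)!!}.$$ -/

import Mathlib

open scoped Matrix Nat

noncomputable section

namespace KrylovPhi

/-- The entire function `φ(z) = (e^z - 1) / z`, `φ(0) = 1`, evaluated at an element `x` of a real
topological algebra (for instance a number or a square matrix) through its Taylor series
`φ(x) = ∑_{j ≥ 0} x^j / (j+1)!`. -/
def phi {R : Type*} [Ring R] [Algebra ℝ R] [TopologicalSpace R] (x : R) : R :=
  ∑' j : ℕ, (((j + 1)! : ℕ) : ℝ)⁻¹ • x ^ j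

/-- The Taylor series of `φ` converges absolutely in every complete normed algebra. -/
theorem summable_phi {R : Type*} [NormedRing R] [NormedAlgebra ℝ R] [CompleteSpace R] (x : R) :
    Summable fun j : ℕ => (((j + 1)! : ℕ) : ℝ)⁻¹ • x ^ j := by
  have h := NormedSpace.norm_expSeries_summable' (𝕂 := ℝ) x
  refine Summable.of_norm_bounded h fun j => ?_
  rw [norm_smul, norm_smul]
  refine mul_le_mul_of_nonneg_right ?_ (norm_nonneg _)
  rw [norm_inv, norm_inv, Real.norm_natCast, Real.norm_natCast]
  have h1 : (0 : ℝ) < ((j ! : ℕ) : ℝ) := by exact_mod_cast Nat.factorial_pos j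
  have h2 : ((j ! : ℕ) : ℝ) ≤ (((j + 1)! : ℕ) : ℝ) := by
    exact_mod_cast Nat.factorial_le (Nat.le_succ j)
  exact inv_anti₀ h1 h2

/-- The Taylor series of `φ` converges at every real square matrix. -/
theorem hasSum_phi_matrix {k : ℕ} (M : Matrix (Fin k) (Fin k) ℝ) :
    HasSum (fun j : ℕ => (((j + 1)! : ℕ) : ℝ)⁻¹ • M ^ j) (phi M) := by
  let _ : NormedRing (Matrix (Fin k) (Fin k) ℝ) := Matrix.linftyOpNormedRing
  let _ : NormedAlgebra ℝ (Matrix (Fin k) (Fin k) ℝ) := Matrix.linftyOpNormedAlgebra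
  exact (summable_phi M).hasSum

/-- For complex numbers `phi` is the function `(e^z - 1) / z`, continued by `1` to `z = 0`. -/
theorem phi_complex (z : ℂ) : phi z = if z = 0 then 1 else (Complex.exp z - 1) / z := by
  have hs := (summable_phi z).hasSum
  change HasSum _ (phi z) at hs
  split_ifs with hz
  · subst hz
    refine hs.unique ?_
    have h := hasSum_single (f := fun j : ℕ => (((j + 1)! : ℕ) : ℝ)⁻¹ • (0 : ℂ) ^ j) 0
      (fun j hj => by simp [hj])
    simpa using h
  · have h1 : HasSum (fun j : ℕ => (((j ! : ℕ) : ℝ))⁻¹ • z ^ j) (Complex.exp z) := by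
      have h := NormedSpace.exp_series_hasSum_exp' (𝕂 := ℝ) z
      rwa [← Complex.exp_eq_exp_ℂ] at h
    have h2 := (hasSum_nat_add_iff' 1).mpr h1
    have h3 := hs.mul_left z
    have h4 : z * phi z = Complex.exp z - 1 := by
      refine h3.unique ?_
      have h5 : (fun j : ℕ => z * ((((j + 1)! : ℕ) : ℝ)⁻¹ • z ^ j)) =
          fun j : ℕ => (((j + 1)! : ℕ) : ℝ)⁻¹ • z ^ (j + 1) := by
        funext j
        rw [pow_succ', mul_smul_comm]
      rw [h5]
      simpa using h2
    rw [← h4, mul_div_cancel_left₀ _ hz]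

/-- The Euclidean norm on `ℝⁿ`. -/
def norm2 {n : ℕ} (x : Fin n → ℝ) : ℝ := ‖WithLp.toLp 2 x‖

/-- The basis vectors `v₁, v₂, …` (numbered from `0`) of the Arnoldi process for the matrix `A` and
the starting vector `b`: `v₁ = b / ‖b‖`, and `v_{j+1} = w / ‖w‖` with
`w = A v_j - ∑_{i ≤ j} (v_iᵀ A v_j) v_i`, so `h_{j+1,j} = ‖w‖`.
If the process terminates (`w = 0`) then all further vectors are `0`; this does not change
the Krylov approximation below any more. -/
def arnoldiVec {n : ℕ} (A : Matrix (Fin n) (Fin n) ℝ) (b : Fin n → ℝ) : ℕ → Fin n → ℝ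
  | 0 => (norm2 b)⁻¹ • b
  | j + 1 =>
    let w : Fin n → ℝ := A *ᵥ arnoldiVec A b j -
      ∑ i : Fin (j + 1),
        (arnoldiVec A b (i : ℕ) ⬝ᵥ (A *ᵥ arnoldiVec A b j)) • arnoldiVec A b (i : ℕ)
    (norm2 w)⁻¹ • w
  termination_by j => j
  decreasing_by all_goals omega

/-- `V_k = [v₁ … v_k] ∈ ℝ^{n × k}`. -/
def arnoldiV {n : ℕ} (A : Matrix (Fin n) (Fin n) ℝ) (b : Fin n → ℝ) (k : ℕ) :
    Matrix (Fin n) (Fin k) ℝ :=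
  Matrix.of fun i j => arnoldiVec A b (j : ℕ) i

/-- `H_k = V_kᵀ A V_k ∈ ℝ^{k × k}`. -/
def arnoldiH {n : ℕ} (A : Matrix (Fin n) (Fin n) ℝ) (b : Fin n → ℝ) (k : ℕ) :
    Matrix (Fin k) (Fin k) ℝ :=
  (arnoldiV A b k)ᵀ * A * arnoldiV A b k

/-- `e₁ = (1, 0, …, 0)ᵀ ∈ ℝ^k`. -/
def e1 (k : ℕ) : Fin k → ℝ := fun i => if (i : ℕ) = 0 then 1 else 0

/-- The Krylov subspace approximation after `k` Arnoldi steps to the solution of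
`y' = -A y + g`, `y(0) = v`:
`y_k(t) = v + V_k (t φ(-t H_k) (β e₁))`, where `V_k`, `H_k` come from the Arnoldi process
started with `g - A v`, and `β = ‖g - A v‖`. -/
def krylovApprox {n : ℕ} (A : Matrix (Fin n) (Fin n) ℝ) (g v : Fin n → ℝ) (k : ℕ) (t : ℝ) :
    Fin n → ℝ :=
  v + arnoldiV A (g - A *ᵥ v) k *ᵥ
    (t • (phi (-t • arnoldiH A (g - A *ᵥ v) k) *ᵥ (norm2 (g - A *ᵥ v) • e1 k)))

/-- The residual `r_k(t) = -A y_k(t) + g - y_k'(t)`. -/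
def krylovResidual {n : ℕ} (A : Matrix (Fin n) (Fin n) ℝ) (g v : Fin n → ℝ) (k : ℕ) (t : ℝ) :
    Fin n → ℝ :=
  -(A *ᵥ krylovApprox A g v k t) + g - deriv (krylovApprox A g v k) t

end KrylovPhi

end

/-!
With `b = g - A v`, the Arnoldi relation `A V = V H + w e_kᵀ` collapses the residual to a multiple
of `w`, namely `-‖b‖ (t φ(-tH))_{k,1} w`. The vector `w` is orthogonal to `v_1, …, v_k`, so
`‖w‖ ≤ ‖A - c‖ ≤ c`. Since `H` is upper Hessenberg, `p(H)_{k,1} = 0` for every polynomial `p` of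
degree less than `k - 1`; hence `|exp(-sH)_{k,1}|` is at most the distance of `exp(-s ·)` from these
polynomials on `[0, 2c]`, which interpolation at the Chebyshev zeros bounds by
`2 (sc/2)^{k-1} / (k-1)!`. The entry of `t φ(-tH)` is the integral of that of `exp(-sH)` over
`[0, t]`, which gives `‖r_k(t)‖ ≤ 4 ‖b‖ (ct)^k / (2k)‼`.
-/

noncomputable section

namespace KrylovPhi

section Interpolation

open Polynomial

theorem exists_iteratedDeriv_eq_zero {a b : ℝ} {m : ℕ} {f : ℝ → ℝ} (hf : ContDiff ℝ m f)
    {S : Finset ℝ} (hcard : S.card = m + 1) (hS : ∀ x ∈ S, x ∈ Set.Icc a b)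
    (hzero : ∀ x ∈ S, f x = 0) : ∃ ξ ∈ Set.Icc a b, iteratedDeriv m f ξ = 0 := by
  induction m generalizing f S with
  | zero =>
    obtain ⟨x, hx⟩ := Finset.card_pos.mp (by omega : 0 < S.card)
    exact ⟨x, hS x hx, by simpa using hzero x hx⟩
  | succ m ih =>
    have hf' : ContDiff ℝ m (deriv f) := by
      rw [Nat.cast_succ] at hf
      exact (contDiff_succ_iff_deriv.mp hf).2.2
    let e := S.orderEmbOfFin hcard
    have he : ∀ i, e i ∈ S := S.orderEmbOfFin_mem hcard
    have rolle (i : Fin (m + 1)) : ∃ d ∈ Set.Ioo (e i.castSucc) (e i.succ), deriv f d = 0 :=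
      exists_deriv_eq_zero (e.strictMono i.castSucc_lt_succ) hf.continuous.continuousOn
        (by rw [hzero _ (he _), hzero _ (he _)])
    choose d hd hd_zero using rolle
    have hd_mono : StrictMono d := Fin.strictMono_iff_lt_succ.mpr fun i =>
      (hd i.castSucc).2.trans (hd i.succ).1
    obtain ⟨ξ, hξ, hξ_zero⟩ := ih hf' (S := Finset.univ.map ⟨d, hd_mono.injective⟩) (by simp)
      (by simpa using fun i => ⟨(hS _ (he _)).1.trans (hd i).1.le,
        (hd i).2.le.trans (hS _ (he _)).2⟩)
      (by simpa using hd_zero)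
    exact ⟨ξ, hξ, by rwa [iteratedDeriv_succ']⟩

theorem iteratedDeriv_eval (p : ℝ[X]) (m : ℕ) :
    iteratedDeriv m (fun x => p.eval x) = fun x => (derivative^[m] p).eval x := by
  induction m generalizing p with
  | zero => simp
  | succ m ih =>
    have hderiv : _root_.deriv (fun x => p.eval x) = fun x => (derivative p).eval x :=
      funext fun x => p.deriv
    rw [iteratedDeriv_succ', Function.iterate_succ_apply, hderiv, ih]

theorem iteratedDeriv_eval_of_natDegree_le {p : ℝ[X]} {m : ℕ} (hp : p.natDegree ≤ m) (x : ℝ) :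
    iteratedDeriv m (fun x => p.eval x) x = m ! * p.coeff m := by
  have hconst : (derivative^[m] p).natDegree ≤ 0 :=
    (natDegree_iterate_derivative p m).trans (by omega)
  simp only [iteratedDeriv_eval]
  rw [eq_C_of_natDegree_le_zero hconst, eval_C, coeff_iterate_derivative]
  simp [Nat.descFactorial_self]

theorem exists_iteratedDeriv_eq_factorial_mul_coeff {a b : ℝ} {m : ℕ} {f : ℝ → ℝ}
    (hf : ContDiff ℝ m f) {q : ℝ[X]} (hq : q.natDegree ≤ m) {S : Finset ℝ}
    (hcard : S.card = m + 1) (hS : ∀ x ∈ S, x ∈ Set.Icc a b) (hinterp : ∀ x ∈ S, q.eval x = f x) :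
    ∃ ξ ∈ Set.Icc a b, iteratedDeriv m f ξ = m ! * q.coeff m := by
  have hq_smooth : ContDiff ℝ m fun x => q.eval x := by
    simpa using Polynomial.contDiff_aeval (𝕜 := ℝ) q m
  obtain ⟨ξ, hξ, hξ_zero⟩ := exists_iteratedDeriv_eq_zero (hf.sub hq_smooth) hcard hS
    fun x hx => sub_eq_zero.mpr (hinterp x hx).symm
  refine ⟨ξ, hξ, ?_⟩
  rwa [← Pi.sub_def, iteratedDeriv_sub hf.contDiffAt hq_smooth.contDiffAt,
    iteratedDeriv_eval_of_natDegree_le hq, sub_eq_zero] at hξ_zero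

theorem exists_sub_eval_interpolate_eq {ι : Type*} [DecidableEq ι] {a b x : ℝ} {f : ℝ → ℝ}
    {s : Finset ι} {v : ι → ℝ} (hf : ContDiff ℝ s.card f) (hv : Set.InjOn v s)
    (hmem : ∀ i ∈ s, v i ∈ Set.Icc a b) (hx : x ∈ Set.Icc a b) :
    ∃ ξ ∈ Set.Icc a b, f x - (Lagrange.interpolate s v (f ∘ v)).eval x =
      iteratedDeriv s.card f ξ / s.card ! * (Lagrange.nodal s v).eval x := by
  set m := s.card
  set p := Lagrange.interpolate s v (f ∘ v)
  set w := Lagrange.nodal s v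
  have hp_node : ∀ i ∈ s, p.eval (v i) = f (v i) := fun i hi =>
    Lagrange.eval_interpolate_at_node _ hv hi
  have hw_node : ∀ i ∈ s, w.eval (v i) = 0 := fun i hi => Lagrange.eval_nodal_at_node hi
  by_cases hxs : ∃ i ∈ s, v i = x
  · obtain ⟨i, hi, rfl⟩ := hxs
    exact ⟨v i, hx, by simp [hp_node i hi, hw_node i hi]⟩
  push Not at hxs
  have hwx : w.eval x ≠ 0 := Lagrange.eval_nodal_not_at_node fun i hi => (hxs i hi).symm
  -- `q` interpolates `f` at the nodes and at `x`, with leading coefficient `κ`.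
  set κ := (f x - p.eval x) / w.eval x with hκ
  set q := p + C κ * w with hq
  have hp_deg : p.degree < m := Lagrange.degree_interpolate_lt _ hv
  have hw_deg : w.natDegree = m := Lagrange.natDegree_nodal
  have hq_deg : q.natDegree ≤ m := natDegree_add_le_of_degree_le
    (natDegree_le_of_degree_le hp_deg.le) ((natDegree_C_mul_le _ _).trans hw_deg.le)
  have hq_coeff : q.coeff m = κ := by
    have hw_coeff : w.coeff m = 1 := hw_deg ▸ Lagrange.nodal_monic.coeff_natDegree
    rw [hq, coeff_add, coeff_C_mul, coeff_eq_zero_of_degree_lt hp_deg, hw_coeff, zero_add, mul_one]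
  have hqx : q.eval x = f x := by simp [hq, hκ, hwx]
  have hq_node : ∀ i ∈ s, q.eval (v i) = f (v i) := fun i hi => by
    simp [hq, hp_node i hi, hw_node i hi]
  have hx_notMem : x ∉ s.image v := by simpa using hxs
  obtain ⟨ξ, hξ, hderiv⟩ := exists_iteratedDeriv_eq_factorial_mul_coeff
    (S := insert x (s.image v)) hf hq_deg
    (by rw [Finset.card_insert_of_notMem hx_notMem, Finset.card_image_of_injOn hv])
    (by simpa using ⟨hx, hmem⟩)
    (by simpa using ⟨hqx, hq_node⟩)
  refine ⟨ξ, hξ, ?_⟩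
  rw [hderiv, hq_coeff, mul_div_cancel_left₀ _ (by positivity), hκ, div_mul_cancel₀ _ hwx]

/-- The zeros `cos ((2 i + 1) π / (2 m))` of the Chebyshev polynomial `T_m`, used as
interpolation nodes; only `i < m` is meaningful. -/
def chebyshevZero (m i : ℕ) : ℝ := Real.cos ((2 * i + 1) * Real.pi / (2 * m))

theorem chebyshevZero_injOn (m : ℕ) : Set.InjOn (chebyshevZero m) (Finset.range m) :=
  (Finset.range m).nodup_map_iff_injOn.mp (Chebyshev.roots_T_real_nodup m)

theorem eval_chebyshev_T_eq_prod (m : ℕ) (x : ℝ) :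
    (Chebyshev.T ℝ m).eval x =
      2 ^ (m - 1) * ∏ i ∈ Finset.range m, (x - chebyshevZero m i) := by
  have hroots : (Chebyshev.T ℝ m).roots = (Finset.range m).val.map (chebyshevZero m) := by
    rw [Chebyshev.roots_T_real, Finset.image_val]
    exact (Chebyshev.roots_T_real_nodup m).dedup
  have hcard : (Chebyshev.T ℝ m).roots.card = (Chebyshev.T ℝ m).natDegree := by
    simp [hroots, Chebyshev.natDegree_T]
  have hlead : (Chebyshev.T ℝ m).leadingCoeff = 2 ^ (m - 1) := by
    simp [Chebyshev.leadingCoeff_T]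
  rw [← C_leadingCoeff_mul_prod_multiset_X_sub_C hcard, hlead, hroots, Multiset.map_map,
    eval_mul, eval_C, eval_multiset_prod, Multiset.map_map, Finset.prod_eq_multiset_prod]
  simp only [Function.comp_apply, eval_sub, eval_X, eval_C]

theorem abs_prod_sub_chebyshevZero_le (m : ℕ) {x : ℝ} (hx : |x| ≤ 1) :
    |∏ i ∈ Finset.range m, (x - chebyshevZero m i)| ≤ 2 / 2 ^ m := by
  rcases m with _ | m
  · simp
  have hT := Chebyshev.abs_eval_T_real_le_one (m + 1 : ℕ) hx
  rw [eval_chebyshev_T_eq_prod, abs_mul, abs_pow, abs_two, Nat.add_sub_cancel] at hT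
  rw [le_div_iff₀ (by positivity), pow_succ]
  linarith

theorem exists_polynomial_abs_sub_le {a r M : ℝ} (hr : 0 < r) {m : ℕ} {f : ℝ → ℝ}
    (hf : ContDiff ℝ m f) (hM : ∀ ξ ∈ Set.Icc (a - r) (a + r), |iteratedDeriv m f ξ| ≤ M) :
    ∃ p : ℝ[X], p.degree < m ∧ ∀ x ∈ Set.Icc (a - r) (a + r),
      |f x - p.eval x| ≤ 2 * M * (r / 2) ^ m / m ! := by
  set v : ℕ → ℝ := fun i => a + r * chebyshevZero m i with hv_def
  have hv : Set.InjOn v (Finset.range m) := fun i hi j hj hij =>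
    chebyshevZero_injOn m hi hj (mul_left_cancel₀ hr.ne' (add_left_cancel hij))
  have hmem (i : ℕ) : v i ∈ Set.Icc (a - r) (a + r) := by
    have hlower : -1 ≤ chebyshevZero m i := Real.neg_one_le_cos _
    have hupper : chebyshevZero m i ≤ 1 := Real.cos_le_one _
    constructor <;> nlinarith
  refine ⟨Lagrange.interpolate (Finset.range m) v (f ∘ v),
    by simpa using Lagrange.degree_interpolate_lt (f ∘ v) hv, fun x hx => ?_⟩
  obtain ⟨ξ, hξ, herror⟩ := exists_sub_eval_interpolate_eq (s := Finset.range m)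
    (by simpa using hf) hv (fun i _ => hmem i) hx
  have hnodal : |(Lagrange.nodal (Finset.range m) v).eval x| ≤ r ^ m * (2 / 2 ^ m) := by
    have hy : |(x - a) / r| ≤ 1 := by
      rw [abs_div, abs_of_pos hr, div_le_one hr, abs_le]
      exact ⟨by linarith [hx.1], by linarith [hx.2]⟩
    have hfactor (i : ℕ) : x - v i = r * ((x - a) / r - chebyshevZero m i) := by
      rw [hv_def]; field_simp; ring
    rw [Lagrange.eval_nodal, Finset.prod_congr rfl fun i _ => hfactor i, Finset.prod_mul_distrib,
      Finset.prod_const, Finset.card_range, abs_mul, abs_of_pos (pow_pos hr m)]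
    gcongr
    exact abs_prod_sub_chebyshevZero_le m hy
  rw [herror, Finset.card_range, abs_mul, abs_div, Nat.abs_cast]
  calc |iteratedDeriv m f ξ| / m ! * |(Lagrange.nodal (Finset.range m) v).eval x|
      ≤ M / m ! * (r ^ m * (2 / 2 ^ m)) := by
        have hM_nonneg : 0 ≤ M := (abs_nonneg _).trans (hM ξ hξ)
        gcongr
        exact hM ξ hξ
    _ = 2 * M * (r / 2) ^ m / m ! := by rw [div_pow]; ring

theorem exists_polynomial_abs_exp_sub_le {c s : ℝ} (hc : 0 < c) (hs : 0 ≤ s) (m : ℕ) :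
    ∃ p : ℝ[X], p.degree < m ∧ ∀ x ∈ Set.Icc 0 (2 * c),
      |Real.exp (-s * x) - p.eval x| ≤ 2 * (s * c / 2) ^ m / m ! := by
  have hbound : ∀ ξ ∈ Set.Icc (c - c) (c + c),
      |iteratedDeriv m (fun x => Real.exp (-s * x)) ξ| ≤ s ^ m := fun ξ hξ => by
    have hexp : Real.exp (-s * ξ) ≤ 1 :=
      Real.exp_le_one_iff.mpr (by nlinarith [hξ.1])
    rw [iteratedDeriv_exp_const_mul, abs_mul, abs_pow, abs_neg, abs_of_nonneg hs, Real.abs_exp]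
    exact mul_le_of_le_one_right (by positivity) hexp
  obtain ⟨p, hp, happrox⟩ := exists_polynomial_abs_sub_le hc (by fun_prop) hbound
  rw [sub_self, ← two_mul] at happrox
  exact ⟨p, hp, fun x hx => (happrox x hx).trans_eq (by ring)⟩

end Interpolation

section Phi

open NormedSpace (exp)

variable {R : Type*} [NormedRing R] [NormedAlgebra ℝ R] [CompleteSpace R]

theorem hasSum_phi (x : R) : HasSum (fun j : ℕ => (((j + 1)! : ℕ) : ℝ)⁻¹ • x ^ j) (phi x) :=
  (summable_phi x).hasSum

theorem mul_phi (x : R) : x * phi x = exp x - 1 := by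
  have hphi : HasSum (fun j : ℕ => (((j + 1)! : ℕ) : ℝ)⁻¹ • x ^ (j + 1)) (x * phi x) := by
    simpa only [mul_smul_comm, ← pow_succ'] using (hasSum_phi x).mul_left x
  have hexp := (hasSum_nat_add_iff' 1).mpr (NormedSpace.exp_series_hasSum_exp' (𝕂 := ℝ) x)
  exact hphi.unique (by simpa using hexp)

theorem integral_exp_smul (x : R) (t : ℝ) : ∫ s in 0..t, exp (s • x) = t • phi (t • x) := by
  have hterm (s : ℝ) (j : ℕ) : ((j ! : ℝ)⁻¹ • (s • x) ^ j) = s ^ j • ((j ! : ℝ)⁻¹ • x ^ j) := by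
    rw [smul_pow, smul_comm]
  have hsum : HasSum (fun j : ℕ => ∫ s in 0..t, (j ! : ℝ)⁻¹ • (s • x) ^ j)
      (∫ s in 0..t, exp (s • x)) := by
    refine intervalIntegral.hasSum_integral_of_dominated_convergence
      (fun j _ => ‖(j ! : ℝ)⁻¹ • (t • x) ^ j‖) (fun j => by fun_prop)
      (fun j => .of_forall fun s hs => ?_)
      (.of_forall fun s _ => NormedSpace.norm_expSeries_summable' (𝕂 := ℝ) (t • x))
      (by simp)
      (.of_forall fun s _ => NormedSpace.exp_series_hasSum_exp' (𝕂 := ℝ) (s • x))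
    have hst : |s| ≤ |t| := by
      simpa using Set.abs_sub_left_of_mem_uIcc (Set.uIoc_subset_uIcc hs)
    rw [hterm s, norm_smul (s ^ j), hterm t, norm_smul (t ^ j), norm_pow, norm_pow,
      Real.norm_eq_abs, Real.norm_eq_abs]
    gcongr
  refine hsum.unique ?_
  convert (hasSum_phi (t • x)).const_smul t using 2 with j
  simp only [hterm]
  rw [intervalIntegral.integral_smul_const, integral_pow, smul_pow, smul_smul, smul_smul,
    smul_smul, Nat.factorial_succ]
  congr 1
  push_cast
  field_simp
  ring

theorem hasDerivAt_smul_phi_neg_smul (x : R) (t : ℝ) :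
    HasDerivAt (fun s : ℝ => s • phi (-s • x)) (exp (-t • x)) t := by
  have hcont : Continuous fun s : ℝ => exp (s • -x) :=
    continuous_iff_continuousAt.mpr fun s =>
      (hasDerivAt_exp_smul_const (𝕂 := ℝ) (-x) s).continuousAt
  have hderiv := (hcont.integral_hasStrictDerivAt 0 t).hasDerivAt
  simp only [integral_exp_smul] at hderiv
  simpa only [smul_neg, ← neg_smul] using hderiv

theorem mul_smul_phi_neg_smul (x : R) (t : ℝ) : x * (t • phi (-t • x)) = 1 - exp (-t • x) := by
  rw [← neg_sub, ← mul_phi, neg_smul, neg_mul, neg_neg, mul_smul_comm, smul_mul_assoc]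

end Phi

section Hessenberg

open Polynomial

/-- A square matrix is upper Hessenberg if its entries below the first subdiagonal vanish, as they
do for the projected matrices `H_k` of the Arnoldi process. -/
def IsUpperHessenberg {R : Type*} [Zero R] {k : ℕ} (H : Matrix (Fin k) (Fin k) R) : Prop :=
  ∀ i j : Fin k, (j : ℕ) + 1 < i → H i j = 0

variable {R : Type*} [Semiring R] {k : ℕ} {H : Matrix (Fin k) (Fin k) R}

theorem IsUpperHessenberg.pow_apply_eq_zero (hH : IsUpperHessenberg H) {m : ℕ} {i j : Fin k}
    (hij : (j : ℕ) + m < i) : (H ^ m) i j = 0 := by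
  induction m generalizing i with
  | zero => exact Matrix.one_apply_ne (by rintro rfl; omega)
  | succ m ih =>
    rw [pow_succ', Matrix.mul_apply]
    refine Finset.sum_eq_zero fun l _ => ?_
    rcases lt_or_ge ((j : ℕ) + m) l with hl | hl
    · rw [ih hl, mul_zero]
    · rw [hH i l (by omega), zero_mul]

theorem IsUpperHessenberg.aeval_apply_eq_zero {S : Type*} [CommSemiring S] [Algebra S R]
    (hH : IsUpperHessenberg H) {p : S[X]} {m : ℕ} (hp : p.degree < m) {i j : Fin k}
    (hij : (j : ℕ) + m ≤ i) : aeval H p i j = 0 := by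
  rw [aeval_eq_sum_range, Matrix.sum_apply]
  refine Finset.sum_eq_zero fun l _ => ?_
  rw [Matrix.smul_apply]
  rcases lt_or_ge l m with hl | hl
  · rw [hH.pow_apply_eq_zero (by omega), smul_zero]
  · rw [coeff_eq_zero_of_degree_lt (hp.trans_le (by exact_mod_cast hl)), zero_smul]

end Hessenberg

section Spectrum

open Matrix
open scoped Matrix.Norms.L2Operator MatrixOrder ComplexOrder

variable {𝕜 : Type*} [RCLike 𝕜] {m n : Type*} [Fintype n] [DecidableEq n]

theorem norm_apply_le_l2_opNorm [Fintype m] (M : Matrix m n 𝕜) (i : m) (j : n) :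
    ‖M i j‖ ≤ ‖M‖ := by
  have hcol := M.l2_opNorm_mulVec (EuclideanSpace.single j 1)
  have hentry := PiLp.norm_apply_le (WithLp.toLp 2 (M *ᵥ Pi.single j 1)) i
  simp only [PiLp.ofLp_single, mulVec_single_one, PiLp.norm_single, norm_one,
    mul_one, col_apply] at hcol hentry
  exact hentry.trans hcol

theorem spectrum_conjTranspose_mul_mul_subset_Icc [Fintype m] [DecidableEq m]
    {A : Matrix n n 𝕜} (hA : A.IsHermitian) {b : ℝ} (hb : 0 ≤ b)
    (hspec : spectrum ℝ A ⊆ Set.Icc 0 b) {V : Matrix n m 𝕜} (hV : Vᴴ * V ≤ 1) :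
    spectrum ℝ (Vᴴ * A * V) ⊆ Set.Icc 0 b := by
  have hA' : IsSelfAdjoint A := hA
  have hA_nonneg : 0 ≤ A := by
    simpa using (algebraMap_le_iff_le_spectrum (r := (0 : ℝ))).mpr fun x hx => (hspec hx).1
  have hA_le : A ≤ algebraMap ℝ _ b :=
    (le_algebraMap_iff_spectrum_le ..).mpr fun x hx => (hspec hx).2
  have hH : IsSelfAdjoint (Vᴴ * A * V) := isHermitian_conjTranspose_mul_mul V hA
  have hH_nonneg : 0 ≤ Vᴴ * A * V := by
    rw [nonneg_iff_posSemidef] at hA_nonneg ⊢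
    exact hA_nonneg.conjTranspose_mul_mul_same V
  have hH_le : Vᴴ * A * V ≤ algebraMap ℝ _ b := by
    have hsplit : algebraMap ℝ _ b - Vᴴ * A * V =
        Vᴴ * (algebraMap ℝ _ b - A) * V + b • (1 - Vᴴ * V) := by
      simp only [Algebra.algebraMap_eq_smul_one, Matrix.mul_sub, Matrix.sub_mul, smul_sub,
        Matrix.mul_smul, Matrix.smul_mul, Matrix.mul_one]
      abel
    rw [le_iff] at hA_le hV ⊢
    rw [hsplit]
    exact (hA_le.conjTranspose_mul_mul_same V).add (hV.smul hb)
  exact fun x hx => ⟨spectrum_nonneg_of_nonneg hH_nonneg hx,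
    (le_algebraMap_iff_spectrum_le ..).mp hH_le x hx⟩

theorem norm_sub_algebraMap_le {A : Matrix n n ℝ} (hA : A.IsHermitian) {c : ℝ} (hc : 0 ≤ c)
    (hspec : spectrum ℝ A ⊆ Set.Icc 0 (2 * c)) : ‖A - algebraMap ℝ _ c‖ ≤ c := by
  have hA' : IsSelfAdjoint A := hA
  have hcfc : A - algebraMap ℝ _ c = cfc (fun x => x - c) A := by
    rw [cfc_sub .., cfc_id' .., cfc_const ..]
  rw [hcfc]
  refine norm_cfc_le hc fun x hx => abs_le.mpr ?_
  constructor <;> linarith [(hspec hx).1, (hspec hx).2]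

end Spectrum

section Decay

open Polynomial
open NormedSpace (exp)
open scoped Matrix.Norms.L2Operator

theorem exp_neg_smul_eq_cfc {n : Type*} [Fintype n] [DecidableEq n] {A : Matrix n n ℝ}
    (hA : A.IsHermitian) (s : ℝ) : exp (-s • A) = cfc (fun x => Real.exp (-s * x)) A := by
  have hA' : IsSelfAdjoint A := hA
  rw [cfc_comp_const_mul (-s) Real.exp A, CFC.real_exp_eq_normedSpace_exp]

variable {k : ℕ} {H : Matrix (Fin k) (Fin k) ℝ} {c : ℝ}

theorem IsUpperHessenberg.abs_exp_neg_smul_apply_le (hess : IsUpperHessenberg H)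
    (hH : H.IsHermitian) (hc : 0 < c) (hspec : spectrum ℝ H ⊆ Set.Icc 0 (2 * c)) {m : ℕ}
    {i j : Fin k} (hij : (j : ℕ) + m ≤ i) {s : ℝ} (hs : 0 ≤ s) :
    |exp (-s • H) i j| ≤ 2 * (s * c / 2) ^ m / m ! := by
  have hH' : IsSelfAdjoint H := hH
  obtain ⟨p, hp, happrox⟩ := exists_polynomial_abs_exp_sub_le hc hs m
  have hcfc : exp (-s • H) - aeval H p = cfc (fun x => Real.exp (-s * x) - p.eval x) H := by
    rw [cfc_sub .., exp_neg_smul_eq_cfc hH, cfc_polynomial ..]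
  calc |exp (-s • H) i j| = |(exp (-s • H) - aeval H p) i j| := by
        rw [Matrix.sub_apply, hess.aeval_apply_eq_zero hp hij, sub_zero]
    _ ≤ ‖exp (-s • H) - aeval H p‖ :=
        norm_apply_le_l2_opNorm (𝕜 := ℝ) _ i j
    _ ≤ 2 * (s * c / 2) ^ m / m ! := by
        rw [hcfc]
        exact norm_cfc_le (by positivity) fun x hx => happrox x (hspec hx)

theorem IsUpperHessenberg.abs_smul_phi_neg_smul_apply_le (hess : IsUpperHessenberg H)
    (hH : H.IsHermitian) (hc : 0 < c) (hspec : spectrum ℝ H ⊆ Set.Icc 0 (2 * c)) {m : ℕ}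
    {i j : Fin k} (hij : (j : ℕ) + m ≤ i) {t : ℝ} (ht : 0 ≤ t) :
    |(t • phi (-t • H)) i j| ≤ 2 * (c / 2) ^ m * t ^ (m + 1) / (m + 1)! := by
  have hderiv (s : ℝ) : HasDerivAt (fun s : ℝ => (s • phi (-s • H)) i j) (exp (-s • H) i j) s := by
    exact hasDerivAt_pi.mp (hasDerivAt_pi.mp (hasDerivAt_smul_phi_neg_smul H s) i) j
  have hbound (s : ℝ) : HasDerivAt (fun s : ℝ => 2 * (c / 2) ^ m * s ^ (m + 1) / (m + 1)!)
      (2 * (s * c / 2) ^ m / m !) s := by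
    refine (((hasDerivAt_pow (m + 1) s).const_mul _).div_const _).congr_deriv ?_
    rw [Nat.factorial_succ]
    push_cast
    field_simp
    ring
  exact image_norm_le_of_norm_deriv_right_le_deriv_boundary (a := 0) (b := t)
    (fun s _ => (hderiv s).continuousAt.continuousWithinAt)
    (fun s _ => (hderiv s).hasDerivWithinAt) (by simp) hbound
    (fun s hs => hess.abs_exp_neg_smul_apply_le hH hc hspec hij hs.1) ⟨ht, le_rfl⟩

end Decay

section EuclideanNorm

open scoped Matrix.Norms.L2Operator

variable {n : ℕ}

theorem norm2_nonneg (x : Fin n → ℝ) : 0 ≤ norm2 x := norm_nonneg _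

theorem norm2_smul (a : ℝ) (x : Fin n → ℝ) : norm2 (a • x) = |a| * norm2 x :=
  norm_smul a (WithLp.toLp 2 x)

theorem norm2_eq_zero {x : Fin n → ℝ} : norm2 x = 0 ↔ x = 0 := by
  rw [norm2, norm_eq_zero, WithLp.toLp_eq_zero]

theorem dotProduct_self_eq_norm2_sq (x : Fin n → ℝ) : x ⬝ᵥ x = norm2 x ^ 2 := by
  rw [norm2, EuclideanSpace.real_norm_sq_eq]
  simp [dotProduct, sq]

theorem dotProduct_le_norm2_mul_norm2 (x y : Fin n → ℝ) : x ⬝ᵥ y ≤ norm2 x * norm2 y := by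
  simpa [EuclideanSpace.inner_toLp_toLp, norm2, mul_comm] using
    real_inner_le_norm (WithLp.toLp 2 y) (WithLp.toLp 2 x)

theorem norm2_mulVec_le (A : Matrix (Fin n) (Fin n) ℝ) (x : Fin n → ℝ) :
    norm2 (A *ᵥ x) ≤ ‖A‖ * norm2 x :=
  A.l2_opNorm_mulVec (WithLp.toLp 2 x)

theorem norm2_smul_inv_norm2_smul (x : Fin n → ℝ) : norm2 x • (norm2 x)⁻¹ • x = x := by
  by_cases hx : norm2 x = 0
  · rw [norm2_eq_zero.mp hx, smul_zero, smul_zero]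
  · exact smul_inv_smul₀ hx x

theorem inv_norm2_smul_eq_zero_or (x : Fin n → ℝ) :
    (norm2 x)⁻¹ • x = 0 ∨ norm2 ((norm2 x)⁻¹ • x) = 1 := by
  by_cases hx : norm2 x = 0
  · exact .inl (by rw [hx, inv_zero, zero_smul])
  · exact .inr (by rw [norm2_smul, abs_of_nonneg (inv_nonneg.mpr (norm2_nonneg x)),
      inv_mul_cancel₀ hx])

end EuclideanNorm

section Arnoldi

open Matrix
open scoped Matrix.Norms.L2Operator MatrixOrder

variable {n : ℕ} (A : Matrix (Fin n) (Fin n) ℝ) (b : Fin n → ℝ)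

/-- The vector `w_j = A v_j - ∑_{i ≤ j} (v_iᵀ A v_j) v_i` of the Arnoldi process, whose
normalization is `v_{j+1}`. -/
def arnoldiResid (j : ℕ) : Fin n → ℝ :=
  A *ᵥ arnoldiVec A b j -
    ∑ i ∈ Finset.range (j + 1), (arnoldiVec A b i ⬝ᵥ (A *ᵥ arnoldiVec A b j)) • arnoldiVec A b i

theorem arnoldiVec_zero : arnoldiVec A b 0 = (norm2 b)⁻¹ • b := by
  rw [arnoldiVec]

theorem arnoldiVec_succ (j : ℕ) :
    arnoldiVec A b (j + 1) = (norm2 (arnoldiResid A b j))⁻¹ • arnoldiResid A b j := by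
  rw [arnoldiVec, arnoldiResid, Finset.sum_range]

theorem norm2_smul_arnoldiVec_zero : norm2 b • arnoldiVec A b 0 = b := by
  rw [arnoldiVec_zero, norm2_smul_inv_norm2_smul]

theorem norm2_smul_arnoldiVec_succ (j : ℕ) :
    norm2 (arnoldiResid A b j) • arnoldiVec A b (j + 1) = arnoldiResid A b j := by
  rw [arnoldiVec_succ, norm2_smul_inv_norm2_smul]

theorem arnoldiVec_eq_zero_or_norm2_eq_one (j : ℕ) :
    arnoldiVec A b j = 0 ∨ norm2 (arnoldiVec A b j) = 1 := by
  cases j with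
  | zero => exact arnoldiVec_zero A b ▸ inv_norm2_smul_eq_zero_or b
  | succ j => exact arnoldiVec_succ A b j ▸ inv_norm2_smul_eq_zero_or _

theorem norm2_arnoldiVec_le_one (j : ℕ) : norm2 (arnoldiVec A b j) ≤ 1 := by
  rcases arnoldiVec_eq_zero_or_norm2_eq_one A b j with h | h
  · simp [norm2_eq_zero.mpr h]
  · exact h.le

theorem dotProduct_self_smul_arnoldiVec (j : ℕ) :
    (arnoldiVec A b j ⬝ᵥ arnoldiVec A b j) • arnoldiVec A b j = arnoldiVec A b j := by
  rcases arnoldiVec_eq_zero_or_norm2_eq_one A b j with h | h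
  · simp [h]
  · rw [dotProduct_self_eq_norm2_sq, h, one_pow, one_smul]

theorem arnoldiVec_dotProduct_of_lt {i j : ℕ} (hij : i < j) :
    arnoldiVec A b i ⬝ᵥ arnoldiVec A b j = 0 := by
  induction j using Nat.strong_induction_on generalizing i with
  | _ j ih =>
    obtain ⟨j, rfl⟩ : ∃ l, j = l + 1 := ⟨j - 1, by omega⟩
    have hortho : ∀ l ∈ Finset.range (j + 1), l ≠ i →
        arnoldiVec A b i ⬝ᵥ arnoldiVec A b l = 0 := fun l hl hli => by
      rcases lt_or_gt_of_ne hli with h | h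
      · rw [dotProduct_comm, ih i hij h]
      · exact ih l (Finset.mem_range.mp hl) h
    have hproj : arnoldiVec A b i ⬝ᵥ
        ∑ l ∈ Finset.range (j + 1),
          (arnoldiVec A b l ⬝ᵥ (A *ᵥ arnoldiVec A b j)) • arnoldiVec A b l =
        arnoldiVec A b i ⬝ᵥ (A *ᵥ arnoldiVec A b j) := by
      rw [dotProduct_sum, Finset.sum_eq_single_of_mem i (Finset.mem_range.mpr hij)
        fun l hl hli => by rw [dotProduct_smul, hortho l hl hli, smul_zero]]
      conv_rhs => rw [← dotProduct_self_smul_arnoldiVec A b i]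
      rw [dotProduct_smul, smul_dotProduct, smul_eq_mul, smul_eq_mul, mul_comm]
    rw [arnoldiVec_succ, dotProduct_smul, arnoldiResid, dotProduct_sub, hproj, sub_self, smul_zero]

theorem arnoldiVec_dotProduct_of_ne {i j : ℕ} (hij : i ≠ j) :
    arnoldiVec A b i ⬝ᵥ arnoldiVec A b j = 0 := by
  rcases lt_or_gt_of_ne hij with h | h
  · exact arnoldiVec_dotProduct_of_lt A b h
  · rw [dotProduct_comm, arnoldiVec_dotProduct_of_lt A b h]

theorem arnoldiVec_dotProduct_arnoldiResid {i j : ℕ} (hij : i ≠ j + 1) :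
    arnoldiVec A b i ⬝ᵥ arnoldiResid A b j = 0 := by
  rw [← norm2_smul_arnoldiVec_succ, dotProduct_smul, arnoldiVec_dotProduct_of_ne A b hij, smul_zero]

theorem mulVec_arnoldiVec (j : ℕ) :
    A *ᵥ arnoldiVec A b j =
      ∑ i ∈ Finset.range (j + 1),
        (arnoldiVec A b i ⬝ᵥ (A *ᵥ arnoldiVec A b j)) • arnoldiVec A b i + arnoldiResid A b j := by
  rw [arnoldiResid, add_sub_cancel]

theorem dotProduct_mulVec_arnoldiVec_of_lt {x : Fin n → ℝ} {j : ℕ}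
    (hx : ∀ i ≤ j, x ⬝ᵥ arnoldiVec A b i = 0) :
    x ⬝ᵥ (A *ᵥ arnoldiVec A b j) = x ⬝ᵥ arnoldiResid A b j := by
  rw [mulVec_arnoldiVec, dotProduct_add, dotProduct_sum, Finset.sum_eq_zero, zero_add]
  exact fun i hi => by
    rw [dotProduct_smul, hx i (Nat.lt_succ_iff.mp (Finset.mem_range.mp hi)), smul_zero]

theorem arnoldiVec_dotProduct_mulVec_of_lt {i j : ℕ} (hij : j < i) :
    arnoldiVec A b i ⬝ᵥ (A *ᵥ arnoldiVec A b j) = arnoldiVec A b i ⬝ᵥ arnoldiResid A b j :=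
  dotProduct_mulVec_arnoldiVec_of_lt A b fun l hl =>
    arnoldiVec_dotProduct_of_ne A b (by omega)

theorem mulVec_arnoldiVec_eq_sum {j m : ℕ} (hjm : j + 2 ≤ m) :
    A *ᵥ arnoldiVec A b j =
      ∑ i ∈ Finset.range m, (arnoldiVec A b i ⬝ᵥ (A *ᵥ arnoldiVec A b j)) • arnoldiVec A b i := by
  induction m, hjm using Nat.le_induction with
  | base =>
    have hnext : (arnoldiVec A b (j + 1) ⬝ᵥ (A *ᵥ arnoldiVec A b j)) • arnoldiVec A b (j + 1) =
        arnoldiResid A b j := by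
      rw [arnoldiVec_dotProduct_mulVec_of_lt A b j.lt_succ_self, ← norm2_smul_arnoldiVec_succ,
        dotProduct_smul, smul_assoc, dotProduct_self_smul_arnoldiVec]
    rw [Finset.sum_range_succ, hnext, ← mulVec_arnoldiVec]
  | succ m hjm ih =>
    rw [Finset.sum_range_succ, ← ih, arnoldiVec_dotProduct_mulVec_of_lt A b (by omega),
      arnoldiVec_dotProduct_arnoldiResid A b (by omega), zero_smul, add_zero]

theorem norm2_arnoldiResid_le (c : ℝ) (j : ℕ) :
    norm2 (arnoldiResid A b j) ≤ ‖A - algebraMap ℝ _ c‖ := by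
  set w := arnoldiResid A b j
  set u := arnoldiVec A b j
  have hw : ∀ i ≤ j, w ⬝ᵥ arnoldiVec A b i = 0 := fun i hi => by
    rw [dotProduct_comm, arnoldiVec_dotProduct_arnoldiResid A b (by omega)]
  have hww : norm2 w * norm2 w = w ⬝ᵥ ((A - algebraMap ℝ _ c) *ᵥ u) := by
    rw [sub_mulVec, Algebra.algebraMap_eq_smul_one, smul_mulVec, one_mulVec, dotProduct_sub,
      dotProduct_smul, hw j le_rfl, dotProduct_mulVec_arnoldiVec_of_lt A b hw, smul_zero, sub_zero,
      dotProduct_self_eq_norm2_sq, sq]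
  have hle : norm2 w * norm2 w ≤ norm2 w * ‖A - algebraMap ℝ _ c‖ :=
    calc norm2 w * norm2 w ≤ norm2 w * norm2 ((A - algebraMap ℝ _ c) *ᵥ u) :=
          hww.trans_le (dotProduct_le_norm2_mul_norm2 _ _)
      _ ≤ norm2 w * ‖A - algebraMap ℝ _ c‖ := by
          gcongr
          · exact norm2_nonneg w
          · exact (norm2_mulVec_le _ u).trans
              (mul_le_of_le_one_right (norm_nonneg _) (norm2_arnoldiVec_le_one A b j))
  rcases (norm2_nonneg w).eq_or_lt with h | h
  · exact h ▸ norm_nonneg _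
  · exact le_of_mul_le_mul_left hle h

theorem arnoldiH_apply (k : ℕ) (i j : Fin k) :
    arnoldiH A b k i j = arnoldiVec A b i ⬝ᵥ (A *ᵥ arnoldiVec A b j) := by
  rw [arnoldiH, Matrix.mul_assoc, Matrix.mul_apply]
  rfl

theorem isUpperHessenberg_arnoldiH (k : ℕ) : IsUpperHessenberg (arnoldiH A b k) := by
  intro i j hij
  rw [arnoldiH_apply, arnoldiVec_dotProduct_mulVec_of_lt A b (by omega),
    arnoldiVec_dotProduct_arnoldiResid A b (by omega)]

theorem transpose_arnoldiV_mul_self (k : ℕ) :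
    (arnoldiV A b k)ᵀ * arnoldiV A b k =
      diagonal fun j : Fin k => norm2 (arnoldiVec A b j) ^ 2 := by
  ext i j
  change arnoldiVec A b i ⬝ᵥ arnoldiVec A b j = _
  rcases eq_or_ne i j with rfl | hij
  · rw [diagonal_apply_eq, dotProduct_self_eq_norm2_sq]
  · rw [diagonal_apply_ne _ hij, arnoldiVec_dotProduct_of_ne A b (Fin.val_ne_of_ne hij)]

theorem transpose_arnoldiV_mul_self_le_one (k : ℕ) :
    (arnoldiV A b k)ᵀ * arnoldiV A b k ≤ 1 := by
  rw [transpose_arnoldiV_mul_self, ← diagonal_one, Matrix.le_iff, diagonal_sub,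
    posSemidef_diagonal_iff]
  exact fun j => sub_nonneg.mpr
    (pow_le_one₀ (norm2_nonneg _) (norm2_arnoldiVec_le_one A b j))

theorem isHermitian_arnoldiH {A : Matrix (Fin n) (Fin n) ℝ} (hA : A.IsHermitian) (k : ℕ) :
    (arnoldiH A b k).IsHermitian :=
  isHermitian_conjTranspose_mul_mul (arnoldiV A b k) hA

theorem spectrum_arnoldiH_subset_Icc {A : Matrix (Fin n) (Fin n) ℝ} (hA : A.IsHermitian) {a : ℝ}
    (ha : 0 ≤ a) (hspec : spectrum ℝ A ⊆ Set.Icc 0 a) (k : ℕ) :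
    spectrum ℝ (arnoldiH A b k) ⊆ Set.Icc 0 a :=
  spectrum_conjTranspose_mul_mul_subset_Icc hA ha hspec (transpose_arnoldiV_mul_self_le_one A b k)

theorem mul_arnoldiV_succ (k : ℕ) :
    A * arnoldiV A b (k + 1) =
      arnoldiV A b (k + 1) * arnoldiH A b (k + 1) +
        vecMulVec (arnoldiResid A b k) (Pi.single (Fin.last k) 1) := by
  have hcol (j : Fin (k + 1)) (a : Fin n) : (arnoldiV A b (k + 1) * arnoldiH A b (k + 1)) a j =
      (∑ i ∈ Finset.range (k + 1),
        (arnoldiVec A b i ⬝ᵥ (A *ᵥ arnoldiVec A b j)) • arnoldiVec A b i) a := by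
    rw [Finset.sum_range, Matrix.mul_apply, Finset.sum_apply]
    refine Finset.sum_congr rfl fun i _ => ?_
    rw [arnoldiH_apply, Pi.smul_apply, smul_eq_mul, mul_comm]
    rfl
  ext a j
  change (A *ᵥ arnoldiVec A b j) a = _
  rw [Matrix.add_apply, hcol, vecMulVec_apply]
  rcases j.le_last.eq_or_lt with rfl | hj
  · rw [Pi.single_eq_same, mul_one, Fin.val_last, ← Pi.add_apply, ← mulVec_arnoldiVec]
  · have hjk : (j : ℕ) < k := hj
    rw [Pi.single_eq_of_ne hj.ne, mul_zero, add_zero, ← mulVec_arnoldiVec_eq_sum A b (by omega)]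

theorem e1_succ (k : ℕ) : e1 (k + 1) = Pi.single 0 1 := by
  ext i
  simp only [e1, Pi.single_apply, Fin.ext_iff, Fin.val_zero]

theorem arnoldiV_mulVec_smul_e1 (k : ℕ) :
    arnoldiV A b (k + 1) *ᵥ (norm2 b • e1 (k + 1)) = b := by
  rw [e1_succ, mulVec_smul, mulVec_single_one]
  exact norm2_smul_arnoldiVec_zero A b

end Arnoldi

section Residual

open Matrix
open NormedSpace (exp)
open scoped Matrix.Norms.L2Operator

variable {n : ℕ} (A : Matrix (Fin n) (Fin n) ℝ) (g v : Fin n → ℝ)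

theorem hasDerivAt_krylovApprox (k : ℕ) (t : ℝ) :
    HasDerivAt (krylovApprox A g v k)
      (arnoldiV A (g - A *ᵥ v) k *ᵥ
        (exp (-t • arnoldiH A (g - A *ᵥ v) k) *ᵥ (norm2 (g - A *ᵥ v) • e1 k))) t := by
  set V := arnoldiV A (g - A *ᵥ v) k
  set H := arnoldiH A (g - A *ᵥ v) k
  set x := norm2 (g - A *ᵥ v) • e1 k
  have happrox : krylovApprox A g v k = fun s => v + V *ᵥ ((s • phi (-s • H)) *ᵥ x) := by
    ext1 s
    rw [krylovApprox, smul_mulVec]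
  have hlin := (V.mulVecLin ∘ₗ (mulVecBilin ℝ ℝ).flip x).toContinuousLinearMap.hasFDerivAt
    |>.comp_hasDerivAt t (hasDerivAt_smul_phi_neg_smul H t)
  rw [happrox]
  exact hlin.const_add v

theorem krylovResidual_succ (k : ℕ) (t : ℝ) :
    krylovResidual A g v (k + 1) t =
      -(norm2 (g - A *ᵥ v) *
          (t • phi (-t • arnoldiH A (g - A *ᵥ v) (k + 1))) (Fin.last k) 0) •
        arnoldiResid A (g - A *ᵥ v) k := by
  have hderiv := (hasDerivAt_krylovApprox A g v (k + 1) t).deriv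
  set b := g - A *ᵥ v with hb
  set V := arnoldiV A b (k + 1)
  set H := arnoldiH A b (k + 1)
  set x := norm2 b • e1 (k + 1)
  set F := t • phi (-t • H)
  have hVx : V *ᵥ x = b := arnoldiV_mulVec_smul_e1 A b k
  have hlast : (F *ᵥ x) (Fin.last k) = norm2 b * F (Fin.last k) 0 := by
    rw [mulVec_smul, e1_succ, mulVec_single_one, Pi.smul_apply, col_apply, smul_eq_mul]
  have hAVF : A *ᵥ (V *ᵥ (F *ᵥ x)) =
      b - V *ᵥ (exp (-t • H) *ᵥ x) + (norm2 b * F (Fin.last k) 0) • arnoldiResid A b k := by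
    rw [mulVec_mulVec, mul_arnoldiV_succ, add_mulVec, ← mulVec_mulVec, mulVec_mulVec x H,
      mul_smul_phi_neg_smul, sub_mulVec, one_mulVec, mulVec_sub, hVx, vecMulVec_mulVec,
      single_one_dotProduct, hlast, op_smul_eq_smul]
  have happrox : krylovApprox A g v (k + 1) t = v + V *ᵥ (F *ᵥ x) := by
    rw [krylovApprox, smul_mulVec]
  rw [neg_smul, krylovResidual, hderiv, happrox, mulVec_add, hAVF]
  linear_combination (-1 : ℝ) • hb

theorem norm2_krylovResidual_succ_le {A : Matrix (Fin n) (Fin n) ℝ} (hA : A.IsHermitian) {c t : ℝ}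
    (hc : 0 < c) (hspec : spectrum ℝ A ⊆ Set.Icc 0 (2 * c)) (ht : 0 ≤ t) (k : ℕ) :
    norm2 (krylovResidual A g v (k + 1) t) ≤
      norm2 (g - A *ᵥ v) * (4 * (c * t) ^ (k + 1) / ((2 * (k + 1))‼ : ℕ)) := by
  set b := g - A *ᵥ v
  set H := arnoldiH A b (k + 1)
  have hentry : |(t • phi (-t • H)) (Fin.last k) 0| ≤
      2 * (c / 2) ^ k * t ^ (k + 1) / (k + 1)! :=
    (isUpperHessenberg_arnoldiH A b (k + 1)).abs_smul_phi_neg_smul_apply_le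
      (isHermitian_arnoldiH b hA _) hc (spectrum_arnoldiH_subset_Icc b hA (by positivity) hspec _)
      (by simp) ht
  have hresid : norm2 (arnoldiResid A b k) ≤ c :=
    (norm2_arnoldiResid_le A b c k).trans (norm_sub_algebraMap_le hA hc.le hspec)
  calc norm2 (krylovResidual A g v (k + 1) t)
      = norm2 b * (|(t • phi (-t • H)) (Fin.last k) 0| * norm2 (arnoldiResid A b k)) := by
        rw [krylovResidual_succ, norm2_smul, abs_neg, abs_mul, abs_of_nonneg (norm2_nonneg _),
          mul_assoc]
    _ ≤ norm2 b * (2 * (c / 2) ^ k * t ^ (k + 1) / (k + 1)! * c) := by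
        gcongr
        exacts [norm2_nonneg _, norm2_nonneg _]
    _ = norm2 b * (4 * (c * t) ^ (k + 1) / ((2 * (k + 1))‼ : ℕ)) := by
        rw [Nat.doubleFactorial_two_mul, div_pow]
        push_cast
        field_simp
        ring

end Residual

theorem monotone_doubleFactorial : Monotone Nat.doubleFactorial := by
  refine monotone_nat_of_le_succ fun n => ?_
  induction n using Nat.twoStepInduction with
  | zero => simp
  | one => simp [Nat.doubleFactorial]
  | more n ih _ =>
    rw [Nat.doubleFactorial_add_two, Nat.doubleFactorial_add_two]
    gcongr
    exact Nat.le_succ _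

end KrylovPhi

end

theorem propositionP3_general {n : ℕ} (A : Matrix (Fin n) (Fin n) ℝ) (g v : Fin n → ℝ) (c t : ℝ)
    (k : ℕ) (hA : A.IsSymm) (hc : 0 < c) (hspec : spectrum ℝ A ⊆ Set.Icc 0 (2 * c)) (ht : 0 ≤ t)
    (hk : k ≠ 0) :
    DifferentiableAt ℝ (KrylovPhi.krylovApprox A g v k) t ∧
      KrylovPhi.norm2 (KrylovPhi.krylovResidual A g v k t) ≤
        KrylovPhi.norm2 (g - A *ᵥ v) * (4 * (c * t) ^ k / ((2 * k)‼ : ℕ)) := by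
  obtain ⟨k, rfl⟩ := Nat.exists_eq_succ_of_ne_zero hk
  have hA' : A.IsHermitian := by
    rwa [Matrix.IsHermitian, Matrix.conjTranspose_eq_transpose_of_trivial]
  exact ⟨(KrylovPhi.hasDerivAt_krylovApprox A g v _ t).differentiableAt,
    KrylovPhi.norm2_krylovResidual_succ_le g v hA' hc hspec ht k⟩

/-- The residual bound for `k` of order at least `ct` in the symmetric case, under the
normalization `β = ‖g - A v‖ = 1`. The first conjunct says that the derivative in the residual
is a true derivative. -/
theorem propositionP3 {n : ℕ} (A : Matrix (Fin n) (Fin n) ℝ) (g v : Fin n → ℝ) (c t : ℝ) (k : ℕ)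
    (hA : A.IsSymm) (hc : 0 < c) (hspec : spectrum ℝ A ⊆ Set.Icc 0 (2 * c))
    (hβ : KrylovPhi.norm2 (g - A *ᵥ v) = 1)
    (ht : 0 ≤ t) (hk : max (5 * c * t) 2 ≤ (k : ℝ)) :
    DifferentiableAt ℝ (KrylovPhi.krylovApprox A g v k) t ∧
      KrylovPhi.norm2 (KrylovPhi.krylovResidual A g v k t) ≤
        16 * (c * t) ^ k / ((2 * k - 1)‼ : ℕ) := by
  have hk0 : k ≠ 0 := by
    rintro rfl
    norm_num at hk
  obtain ⟨hdiff, hbound⟩ := propositionP3_general A g v c t k hA hc hspec ht hk0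
  rw [hβ, one_mul] at hbound
  refine ⟨hdiff, hbound.trans ?_⟩
  gcongr
  · norm_num
  · exact KrylovPhi.monotone_doubleFactorial (Nat.sub_le _ _)
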